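/- Let $G$ be a finite simple graph with maximum degree $\Delta$, and suppose that $G$ is $3$-degenerate, that is, every nonempty subgraph of $G$ has a vertex of degree at most $3$ in that subgraph. Then $a'(G) \le \Delta + 5$. Here an acyclic edge colouring of $G$ is a proper edge colouring (distinct edges sharing an endpoint receive different colours) in which no cycle is bichromatic (coloured with exactly two colours), and the acyclic chromatic index $a'(G)$ is the minimum number of colours in an acyclic edge colouring of $G$. -/

import Mathlib

namespace SimpleGraph

/-- A graph is `k`-degenerate if every (nonempty) subgraph has a vertex whose degree in that
subgraph is at most `k`. -/
def IsDegenerate {V : Type*} (G : SimpleGraph V) (k : ℕ) : Prop :=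
  ∀ H : G.Subgraph, H.verts.Nonempty → ∃ v ∈ H.verts, (H.neighborSet v).encard ≤ k

namespace EdgeLabeling

/-- An edge labeling is a proper edge coloring if any two distinct edges that share an endpoint
receive different colors. -/
def IsProper {V K : Type*} {G : SimpleGraph V} (C : G.EdgeLabeling K) : Prop :=
  ∀ e₁ e₂ : G.edgeSet, e₁ ≠ e₂ →
    (∃ v : V, v ∈ (e₁ : Sym2 V) ∧ v ∈ (e₂ : Sym2 V)) → C e₁ ≠ C e₂

/-- The set of colors that occur on the edges of a walk. -/
def walkColors {V K : Type*} {G : SimpleGraph V} (C : G.EdgeLabeling K) {u v : V}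
    (p : G.Walk u v) : Set K :=
  {c | ∃ e : G.edgeSet, (e : Sym2 V) ∈ p.edges ∧ C e = c}

/-- An edge labeling is an acyclic edge coloring if it is proper and there is no bichromatic
cycle, that is, no cycle whose edges carry exactly two colors. -/
def IsAcyclicColoring {V K : Type*} {G : SimpleGraph V} (C : G.EdgeLabeling K) : Prop :=
  C.IsProper ∧ ∀ (v : V) (p : G.Walk v v), p.IsCycle → (C.walkColors p).encard ≠ 2

end EdgeLabeling

/-- The graph has an acyclic edge coloring with colors from a set of `n` colors. -/
def AcyclicEdgeColorable {V : Type*} (G : SimpleGraph V) (n : ℕ) : Prop :=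
  ∃ C : G.EdgeLabeling (Fin n), C.IsAcyclicColoring

/-- The acyclic chromatic index `a'(G)`: the least number of colors in an acyclic edge coloring
(`⊤` if no finite number of colors suffices). -/
noncomputable def acyclicChromaticIndex {V : Type*} (G : SimpleGraph V) : ℕ∞ :=
  ⨅ (n : ℕ) (_ : G.AcyclicEdgeColorable n), (n : ℕ∞)

end SimpleGraph

/-! Induction on edges. Let `T` be the set of vertices of degree above 3. Degeneracy gives an edge
`xy` with `y` of degree at most 3 and `x` having at most 3 neighbours in `T`. Colour `H`, the graph
without `xy`. At least 6 colours are missing at `x`, and at most 2 occur at `y`.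

A missing colour `a` fails on `xy` only if some colour `e` at `y` blocks it: `a = e`, or an `a`-`e`
path joins `x` to `y`. Unless `e` is a `T`-colour (the colour of an edge from `x` into `T`), the
path enters a vertex with at most two further colours, so `e` blocks at most 2 colours
(`card_blocked_le`). A `T`-colour may block many, but a two-coloured path from `x` has only one
other end (`end_unique`), so it blocks each `a` towards at most one vertex.

Suppose no extension exists, and choose a colouring of `H` with the fewest `T`-colours at `y`. Some
edge `yv` has a `T`-colour `c`. By minimality, every colour missing at `y` and `v` occurs at `x`. At
least three such colours `d` lie on edges `xz` with `z` outside `T`, and no such edge can take a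
colour missing at `x`, since that would free `d`. So the at most two other colours at each `z` block
all missing colours, which `false_of_forall_exists_mem` excludes by counting. -/

namespace SimpleGraph

/-! ### Ends of paths in graphs of maximum degree two -/

/-- Two paths that leave `u` without using `w`, in a graph in which every vertex has at most two
neighbors, end in the same vertex if their ends have at most one neighbor. -/
theorem eq_of_isPath_of_forall_adj {V : Type*} {B : SimpleGraph V}
    (two : ∀ v w w₁ w₂, B.Adj v w → B.Adj v w₁ → B.Adj v w₂ → w₁ ≠ w → w₂ ≠ w → w₁ = w₂)
    {u t t' : V} (p : B.Walk u t) (q : B.Walk u t') (hp : p.IsPath) (hq : q.IsPath)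
    (ht : ∀ w w', B.Adj t w → B.Adj t w' → w = w')
    (ht' : ∀ w w', B.Adj t' w → B.Adj t' w' → w = w')
    (w : V) (hw : B.Adj u w) (hwp : w ∉ p.support) (hwq : w ∉ q.support) : t = t' := by
  induction p generalizing w with
  | nil =>
    cases q with
    | nil => rfl
    | cons h q =>
      exfalso
      have := ht _ _ hw h
      subst this
      simp at hwq
  | @cons u v t h p ih =>
    cases q with
    | nil =>
      exfalso
      have := ht' _ _ hw h
      subst this
      simp at hwp
    | @cons _ v' _ h' q =>
      rw [Walk.cons_isPath_iff] at hp hq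
      have hv : v ≠ w := by rintro rfl; simp at hwp
      have hv' : v' ≠ w := by rintro rfl; simp at hwq
      obtain rfl := two u w v v' hw h h' hv hv'
      exact ih q hp.1 hq.1 ht u h.symm hp.2 hq.2

/-- A component with maximum degree two cannot contain three distinct vertices of degree at most
one: a path has only two ends. -/
theorem eq_of_reachable_of_forall_adj {V : Type*} {B : SimpleGraph V}
    (two : ∀ v w w₁ w₂, B.Adj v w → B.Adj v w₁ → B.Adj v w₂ → w₁ ≠ w → w₂ ≠ w → w₁ = w₂)
    {u t t' : V} (hut : B.Reachable u t) (hut' : B.Reachable u t') (h : u ≠ t) (h' : u ≠ t')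
    (hu : ∀ w w', B.Adj u w → B.Adj u w' → w = w')
    (ht : ∀ w w', B.Adj t w → B.Adj t w' → w = w')
    (ht' : ∀ w w', B.Adj t' w → B.Adj t' w' → w = w') : t = t' := by
  obtain ⟨p, hp⟩ := hut.exists_isPath
  obtain ⟨q, hq⟩ := hut'.exists_isPath
  cases p with
  | nil => exact absurd rfl h
  | cons hv p =>
    cases q with
    | nil => exact absurd rfl h'
    | cons hv' q =>
      rw [Walk.cons_isPath_iff] at hp hq
      obtain rfl := hu _ _ hv hv'
      exact eq_of_isPath_of_forall_adj two p q hp.1 hq.1 ht ht' u hv.symm hp.2 hq.2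

theorem not_reachable_of_forall_not_adj {V : Type*} {B : SimpleGraph V} {u v : V} (huv : u ≠ v)
    (hv : ∀ w, ¬ B.Adj v w) : ¬ B.Reachable u v := by
  intro h
  obtain ⟨p⟩ := h.symm
  cases p with
  | nil => exact huv rfl
  | cons h _ => exact hv _ h

/-! ### Partial colourings, two-coloured subgraphs and recolouring -/

namespace PartialColoring

variable {V K : Type*}

/-- The edges to which a partial coloring of the pairs of vertices gives the color `α` or `β`. -/
def bichromatic (φ : Sym2 V → Option K) (α β : K) : SimpleGraph V where
  Adj u v := u ≠ v ∧ (φ s(u, v) = some α ∨ φ s(u, v) = some β)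
  symm := ⟨fun u v h => by rw [Sym2.eq_swap]; exact ⟨h.1.symm, h.2⟩⟩
  loopless := ⟨fun _ h => h.1 rfl⟩

/-- A partial coloring of the pairs of vertices is valid if it is proper and no two colors form a
cycle. -/
structure IsValid (φ : Sym2 V → Option K) : Prop where
  proper : ∀ v w w' α, φ s(v, w) = some α → φ s(v, w') = some α → w = w'
  acyclic : ∀ α β, α ≠ β → (bichromatic φ α β).IsAcyclic

/-- The valid partial colorings whose colored pairs are the edges of `G`. -/
structure IsColoringOf (φ : Sym2 V → Option K) (G : SimpleGraph V) : Prop extends IsValid φ where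
  ne_none_iff : ∀ u v, φ s(u, v) ≠ none ↔ G.Adj u v

variable {φ : Sym2 V → Option K}

theorem bichromatic_comm (α β : K) : bichromatic φ α β = bichromatic φ β α := by
  ext u v
  simp [bichromatic, or_comm]

theorem IsValid.bichromatic_two (hφ : IsValid φ) (a e : K) (v w w₁ w₂ : V)
    (h : (bichromatic φ a e).Adj v w) (h₁ : (bichromatic φ a e).Adj v w₁)
    (h₂ : (bichromatic φ a e).Adj v w₂) (hw₁ : w₁ ≠ w) (hw₂ : w₂ ≠ w) : w₁ = w₂ := by
  have P := hφ.proper v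
  rcases h.2 with h | h <;> rcases h₁.2 with h₁ | h₁ <;> rcases h₂.2 with h₂ | h₂ <;>
    first
    | exact P _ _ _ h₁ h₂
    | exact absurd (P _ _ _ h₁ h) hw₁
    | exact absurd (P _ _ _ h₂ h) hw₂

open Classical in
/-- Recoloring the pair `uv`. -/
noncomputable def recolor (φ : Sym2 V → Option K) (u v : V) (a : K) : Sym2 V → Option K :=
  Function.update φ s(u, v) (some a)

theorem recolor_self (u v : V) (a : K) : recolor φ u v a s(u, v) = some a := by
  simp [recolor]

theorem recolor_comm (u v : V) (a : K) : recolor φ u v a = recolor φ v u a := by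
  rw [recolor, Sym2.eq_swap, recolor]

theorem recolor_of_ne {u v : V} (a : K) {e : Sym2 V} (h : e ≠ s(u, v)) :
    recolor φ u v a e = φ e := by
  simp [recolor, h]

theorem recolor_eq_some {u v : V} {a α : K} {e : Sym2 V} (h : recolor φ u v a e = some α) :
    e = s(u, v) ∧ α = a ∨ e ≠ s(u, v) ∧ φ e = some α := by
  by_cases he : e = s(u, v)
  · subst he
    rw [recolor_self] at h
    exact .inl ⟨rfl, (Option.some_injective _ h).symm⟩
  · rw [recolor_of_ne a he] at h
    exact .inr ⟨he, h⟩

variable [Fintype K]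

open Classical in
/-- The colors of the pairs that contain `v`. -/
noncomputable def colorsAt (φ : Sym2 V → Option K) (v : V) : Finset K :=
  {α | ∃ w, φ s(v, w) = some α}

theorem mem_colorsAt {v : V} {α : K} : α ∈ colorsAt φ v ↔ ∃ w, φ s(v, w) = some α := by
  simp [colorsAt]

theorem mem_colorsAt_of_eq {v w : V} {α : K} (h : φ s(v, w) = some α) : α ∈ colorsAt φ v :=
  mem_colorsAt.2 ⟨w, h⟩

theorem mem_colorsAt_of_eq' {v w : V} {α : K} (h : φ s(v, w) = some α) : α ∈ colorsAt φ w :=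
  mem_colorsAt.2 ⟨v, by rwa [Sym2.eq_swap]⟩

theorem IsValid.adj_unique (hφ : IsValid φ) {a e : K} {v : V} (ha : a ∉ colorsAt φ v) (w w' : V)
    (h : (bichromatic φ a e).Adj v w) (h' : (bichromatic φ a e).Adj v w') : w = w' := by
  have key : ∀ {w}, (bichromatic φ a e).Adj v w → φ s(v, w) = some e := fun h =>
    h.2.resolve_left fun h => ha (mem_colorsAt_of_eq h)
  exact hφ.proper _ _ _ _ (key h) (key h')

/-- A bichromatic path that starts in `x` determines its other end. -/
theorem IsValid.end_unique (hφ : IsValid φ) {a e : K} {x t t' : V}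
    (hx : a ∉ colorsAt φ x) (ht : a ∉ colorsAt φ t) (ht' : a ∉ colorsAt φ t')
    (hxt : (bichromatic φ a e).Reachable x t) (hxt' : (bichromatic φ a e).Reachable x t')
    (h : x ≠ t) (h' : x ≠ t') : t = t' :=
  eq_of_reachable_of_forall_adj (hφ.bichromatic_two a e) hxt hxt' h h' (hφ.adj_unique hx)
    (hφ.adj_unique ht) (hφ.adj_unique ht')

theorem not_reachable_of_notMem {a e : K} {u v : V} (huv : u ≠ v) (ha : a ∉ colorsAt φ v)
    (he : e ∉ colorsAt φ v) : ¬ (bichromatic φ a e).Reachable u v :=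
  not_reachable_of_forall_not_adj huv fun _ h =>
    h.2.elim (fun h => ha (mem_colorsAt_of_eq h)) (fun h => he (mem_colorsAt_of_eq h))

theorem colorsAt_recolor_of_ne {u v w : V} (a : K) (hu : w ≠ u) (hv : w ≠ v) :
    colorsAt (recolor φ u v a) w = colorsAt φ w := by
  ext α
  simp only [mem_colorsAt]
  refine exists_congr fun w' => ?_
  rw [recolor_of_ne]
  simp [hu, hv]

theorem mem_colorsAt_of_mem_recolor {u v w : V} {a α : K}
    (h : α ∈ colorsAt (recolor φ u v a) w) : α = a ∨ α ∈ colorsAt φ w := by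
  obtain ⟨w', h⟩ := mem_colorsAt.1 h
  rcases recolor_eq_some h with h | h
  · exact .inl h.2
  · exact .inr (mem_colorsAt_of_eq h.2)

theorem IsValid.notMem_colorsAt_recolor (hφ : IsValid φ) {u v : V} {a c : K}
    (h : φ s(u, v) = some c) (hac : c ≠ a) : c ∉ colorsAt (recolor φ u v a) u := by
  intro hc
  obtain ⟨w, hw⟩ := mem_colorsAt.1 hc
  rcases recolor_eq_some hw with hw | hw
  · exact hac hw.2
  · exact hw.1 (by rw [hφ.proper _ _ _ _ h hw.2])

/-- A pair can be recolored if this closes no bichromatic cycle. -/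
theorem IsValid.isValid_recolor (hφ : IsValid φ) {u v : V} (huv : u ≠ v) {a : K}
    (hu : a ∉ colorsAt φ u) (hv : a ∉ colorsAt φ v)
    (h : ∀ e ∈ colorsAt φ v, φ s(u, v) ≠ some e → ¬ (bichromatic φ a e).Reachable u v) :
    IsValid (recolor φ u v a) := by
  have key : ∀ e, e ≠ a → (bichromatic (recolor φ u v a) a e).IsAcyclic := by
    intro e hea
    -- If `uv` had colour `e`, it stays inside the old `a`-`e` graph, which is acyclic whether or
    -- not it joins `u` to `v`.
    by_cases he : φ s(u, v) = some e
    · refine IsAcyclic.anti ?_ (hφ.acyclic a e hea.symm)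
      intro w w' hw
      refine ⟨hw.1, ?_⟩
      rcases hw.2 with hw | hw <;> rcases recolor_eq_some hw with hw | hw
      · rw [hw.1]; exact .inr he
      · exact .inl hw.2
      · exact absurd hw.2 hea
      · exact .inr hw.2
    · have hr : ¬ (bichromatic φ a e).Reachable u v := by
        by_cases hev : e ∈ colorsAt φ v
        · exact h e hev he
        · exact not_reachable_of_notMem huv hv hev
      refine IsAcyclic.anti ?_ ((hφ.acyclic a e hea.symm).sup_edge_of_not_reachable hr)
      intro w w' hw
      rw [sup_adj, adj_edge]
      rcases hw.2 with h' | h' <;> rcases recolor_eq_some h' with h' | h'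
      · exact .inr ⟨h'.1.symm, hw.1⟩
      · exact .inl ⟨hw.1, .inl h'.2⟩
      · exact .inr ⟨h'.1.symm, hw.1⟩
      · exact .inl ⟨hw.1, .inr h'.2⟩
  constructor
  · intro w w₁ w₂ α h₁ h₂
    have aux : ∀ w', s(w, w') = s(u, v) → φ s(w, w₁) = some a ∨ φ s(w, w₂) = some a → False := by
      intro w' hw' ha
      have : w = u ∨ w = v := by
        have : w ∈ s(u, v) := hw' ▸ Sym2.mem_mk_left w w'
        simpa using this
      rcases this with rfl | rfl
      · exact ha.elim (fun h => hu (mem_colorsAt_of_eq h)) fun h => hu (mem_colorsAt_of_eq h)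
      · exact ha.elim (fun h => hv (mem_colorsAt_of_eq h)) fun h => hv (mem_colorsAt_of_eq h)
    rcases recolor_eq_some h₁ with h₁ | h₁ <;> rcases recolor_eq_some h₂ with h₂ | h₂
    · exact Sym2.congr_right.1 (h₁.1.trans h₂.1.symm)
    · exact (aux w₁ h₁.1 (.inr (h₁.2 ▸ h₂.2))).elim
    · exact (aux w₂ h₂.1 (.inl (h₂.2 ▸ h₁.2))).elim
    · exact hφ.proper _ _ _ _ h₁.2 h₂.2
  · intro α β hαβ
    by_cases hα : α = a
    · subst hα
      exact key β hαβ.symm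
    by_cases hβ : β = a
    · subst hβ
      rw [bichromatic_comm]
      exact key α hαβ
    refine IsAcyclic.anti ?_ (hφ.acyclic α β hαβ)
    intro w w' hw
    refine ⟨hw.1, ?_⟩
    rcases hw.2 with hw | hw <;> rcases recolor_eq_some hw with hw | hw
    · exact absurd hw.2 hα
    · exact .inl hw.2
    · exact absurd hw.2 hβ
    · exact .inr hw.2

end PartialColoring
-- The final count
/-- Sets that are small, apart from two families of pairwise disjoint ones, cannot cover a set with
at least six elements three times. -/
theorem false_of_forall_exists_mem {K : Type*} [DecidableEq K] {A D : Finset K} (hA : 6 ≤ A.card)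
    (hD : 3 ≤ D.card) {E : K → Finset K} (hE : ∀ d ∈ D, (E d).card ≤ 2) {B : K → K → Finset K}
    (hcov : ∀ d ∈ D, ∀ a ∈ A, ∃ e ∈ E d, a ∈ B d e) (T₁ T₂ : Finset K)
    (h₀ : ∀ d ∈ D, ∀ e ∈ E d, e ∉ T₁ → e ∉ T₂ → (B d e).card ≤ 2)
    (h₁ : ∀ d ∈ D, ∀ d' ∈ D, ∀ e ∈ T₁, ∀ e' ∈ T₁, ∀ a ∈ A, a ∈ B d e → a ∈ B d' e' → d = d')
    (h₂ : ∀ d ∈ D, ∀ d' ∈ D, ∀ e ∈ T₂, ∀ e' ∈ T₂, ∀ a ∈ A, a ∈ B d e → a ∈ B d' e' → d = d') :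
    False := by
  set P : Finset K → K → Finset K := fun T d => A.filter fun a => ∃ e ∈ E d, e ∈ T ∧ a ∈ B d e
    with hP
  have sum_le : ∀ T, (∀ d ∈ D, ∀ d' ∈ D, ∀ e ∈ T, ∀ e' ∈ T, ∀ a ∈ A, a ∈ B d e → a ∈ B d' e' →
      d = d') → ∑ d ∈ D, (P T d).card ≤ A.card := by
    intro T hT
    rw [← Finset.card_biUnion]
    · exact Finset.card_le_card (Finset.biUnion_subset.2 fun d _ => Finset.filter_subset _ _)
    · intro d hd d' hd' hne
      refine Finset.disjoint_left.2 fun a ha ha' => ?_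
      obtain ⟨haA, e, -, he, hae⟩ := Finset.mem_filter.1 ha
      obtain ⟨-, e', -, he', hae'⟩ := Finset.mem_filter.1 ha'
      exact hne (hT d hd d' hd' e he e' he' a haA hae hae')
  -- Two elements of `E d` outside `T₁ ∪ T₂` would cover at most 4 < 6 elements, so at most one is
  -- outside. Removing `T₁` from `T₂` avoids double counting.
  have each : ∀ d ∈ D, A.card ≤ (P T₁ d).card + 2 ∨ A.card ≤ (P (T₂ \ T₁) d).card + 2 ∨
      A.card ≤ (P T₁ d).card + (P (T₂ \ T₁) d).card := by
    intro d hd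
    have hcard : ((E d).filter (· ∉ T₁ ∪ T₂)).card + ((E d).filter (· ∈ T₁)).card
        + ((E d).filter (· ∈ T₂ \ T₁)).card ≤ (E d).card := by
      rw [← Finset.card_union_of_disjoint, ← Finset.card_union_of_disjoint]
      · refine Finset.card_le_card ?_
        intro e
        simp only [Finset.mem_union, Finset.mem_filter]
        tauto
      · rw [Finset.disjoint_left]
        intro e
        simp only [Finset.mem_union, Finset.mem_filter, Finset.mem_sdiff]
        tauto
      · rw [Finset.disjoint_left]
        intro e
        simp only [Finset.mem_union, Finset.mem_filter]
        tauto
    have hzero : ∀ T, ((E d).filter (· ∈ T)).card = 0 → (P T d).card = 0 := by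
      intro T hT
      rw [Finset.card_eq_zero] at hT ⊢
      rw [Finset.eq_empty_iff_forall_notMem]
      intro a ha
      obtain ⟨-, e, he, heT, -⟩ := Finset.mem_filter.1 ha
      exact Finset.eq_empty_iff_forall_notMem.1 hT e (Finset.mem_filter.2 ⟨he, heT⟩)
    have hsub : A ⊆ P T₁ d ∪ P (T₂ \ T₁) d ∪ ((E d).filter (· ∉ T₁ ∪ T₂)).biUnion (B d) := by
      intro a ha
      obtain ⟨e, he, hae⟩ := hcov d hd a ha
      by_cases e₁ : e ∈ T₁
      · exact Finset.mem_union_left _ (Finset.mem_union_left _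
          (Finset.mem_filter.2 ⟨ha, e, he, e₁, hae⟩))
      by_cases e₂ : e ∈ T₂
      · exact Finset.mem_union_left _ (Finset.mem_union_right _
          (Finset.mem_filter.2 ⟨ha, e, he, Finset.mem_sdiff.2 ⟨e₂, e₁⟩, hae⟩))
      · exact Finset.mem_union_right _ (Finset.mem_biUnion.2
          ⟨e, Finset.mem_filter.2 ⟨he, by simp [e₁, e₂]⟩, hae⟩)
    have hle := (Finset.card_le_card hsub).trans ((Finset.card_union_le _ _).trans
      (Nat.add_le_add_right (Finset.card_union_le _ _) _))
    have hle' : (((E d).filter (· ∉ T₁ ∪ T₂)).biUnion (B d)).card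
        ≤ ((E d).filter (· ∉ T₁ ∪ T₂)).card * 2 := by
      refine Finset.card_biUnion_le_card_mul _ _ _ fun e he => ?_
      rw [Finset.mem_filter, Finset.mem_union, not_or] at he
      exact h₀ d hd e he.1 he.2.1 he.2.2
    have := hE d hd
    have := hzero T₁
    have := hzero (T₂ \ T₁)
    omega
  obtain ⟨D', hD', hcard⟩ := Finset.exists_subset_card_eq hD
  obtain ⟨d₁, d₂, d₃, h12, h13, h23, rfl⟩ := Finset.card_eq_three.1 hcard
  have s₁ := (Finset.sum_le_sum_of_subset hD').trans (sum_le T₁ h₁)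
  have s₂ := (Finset.sum_le_sum_of_subset hD').trans (sum_le (T₂ \ T₁) fun d hd d' hd' e he e' he' =>
    h₂ d hd d' hd' e (Finset.mem_sdiff.1 he).1 e' (Finset.mem_sdiff.1 he').1)
  rw [Finset.sum_insert (by simp [h12, h13]), Finset.sum_pair h23] at s₁ s₂
  have e₁ := each d₁ (hD' (by simp))
  have e₂ := each d₂ (hD' (by simp))
  have e₃ := each d₃ (hD' (by simp))
  -- With `n ≥ 6` elements, each family has total at most `n`, so at most one `d` can have `n - 2`
  -- or more in it. Hence some `d` needs `n` from both families together, and the others at least `n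
  -- - 2` each: in all `3n - 4 > 2n`.
  omega

/-! ### Blocked colours and the extension to one more edge -/

namespace PartialColoring

variable {V K : Type*} {φ : Sym2 V → Option K} {H : SimpleGraph V}

theorem IsColoringOf.adj (hφ : IsColoringOf φ H) {u v : V} {a : K} (h : φ s(u, v) = some a) :
    H.Adj u v :=
  (hφ.ne_none_iff u v).1 (by simp [h])

theorem IsColoringOf.of_isValid_recolor_of_adj (hφ : IsColoringOf φ H) {u v : V} {a : K}
    (h : IsValid (recolor φ u v a)) (huv : H.Adj u v) : IsColoringOf (recolor φ u v a) H := by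
  refine ⟨h, fun w w' => ?_⟩
  by_cases he : s(w, w') = s(u, v)
  · rw [he, recolor_self, ← mem_edgeSet, he]
    simpa using huv
  · rw [recolor_of_ne a he, hφ.ne_none_iff]

theorem IsColoringOf.of_isValid_recolor (hφ : IsColoringOf φ H) {u v : V} {a : K}
    (h : IsValid (recolor φ u v a)) (huv : u ≠ v) :
    IsColoringOf (recolor φ u v a) (H ⊔ edge u v) := by
  refine ⟨h, fun w w' => ?_⟩
  rw [sup_adj, adj_edge]
  by_cases he : s(w, w') = s(u, v)
  · rw [he, recolor_self]
    have : w ≠ w' := by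
      rintro rfl
      have := (Sym2.mk_isDiag_iff (x := w) (y := w)).2 rfl
      rw [he, Sym2.mk_isDiag_iff] at this
      exact huv this
    simp [this]
  · rw [recolor_of_ne a he, hφ.ne_none_iff]
    simp [Ne.symm he]

variable [Fintype K]

open Classical in
/-- The colors missing at `x` that cannot be given to the pair `xt` because of the color `e`. -/
noncomputable def blocked (φ : Sym2 V → Option K) (x t : V) (e : K) : Finset K :=
  {a | a ∉ colorsAt φ x ∧ (a = e ∨ a ∉ colorsAt φ t ∧ (bichromatic φ a e).Reachable x t)}

theorem mem_blocked {x t : V} {a e : K} : a ∈ blocked φ x t e ↔ a ∉ colorsAt φ x ∧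
    (a = e ∨ a ∉ colorsAt φ t ∧ (bichromatic φ a e).Reachable x t) := by
  simp [blocked]

theorem IsColoringOf.card_colorsAt_le (hφ : IsColoringOf φ H) (v : V)
    [Fintype (H.neighborSet v)] : (colorsAt φ v).card ≤ H.degree v := by
  classical
  rw [← card_neighborFinset_eq_degree, ← Finset.card_map Function.Embedding.some]
  refine le_trans (Finset.card_le_card ?_)
    (Finset.card_image_le (s := H.neighborFinset v) (f := fun w => φ s(v, w)))
  intro o ho
  obtain ⟨α, hα, rfl⟩ := Finset.mem_map.1 ho
  obtain ⟨w, hw⟩ := mem_colorsAt.1 hα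
  exact Finset.mem_image.2 ⟨w, by simpa using hφ.adj hw, hw⟩

theorem IsValid.recolor_of_notMem_blocked (hφ : IsValid φ) {u v : V} (huv : u ≠ v) {a : K}
    (hu : a ∉ colorsAt φ u)
    (h : ∀ e ∈ colorsAt φ v, φ s(u, v) ≠ some e → a ∉ blocked φ u v e) :
    IsValid (recolor φ u v a) := by
  have hv : a ∉ colorsAt φ v := fun hv =>
    h a hv (fun h => hu (mem_colorsAt_of_eq h)) (mem_blocked.2 ⟨hu, .inl rfl⟩)
  exact hφ.isValid_recolor huv hu hv fun e he he' hr => h e he he' (mem_blocked.2 ⟨hu, .inr ⟨hv, hr⟩⟩)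

/-- If `e` is at `x`, the blocking path starts with the `e`-edge `xw`. A colour absent from `w`
would end it there instead of at `t`, so blocked colours are among the at most two others at `w`. If
`e` is missing at `x`, it can block only itself. -/
theorem IsColoringOf.card_blocked_le (hφ : IsColoringOf φ H) {x t : V} {e : K} (hxt : x ≠ t)
    (hne : φ s(x, t) ≠ some e)
    (hlow : ∀ w, φ s(x, w) = some e → (colorsAt φ w).card ≤ 3) :
    (blocked φ x t e).card ≤ 2 := by
  classical
  by_cases he : e ∈ colorsAt φ x
  · obtain ⟨w, hw⟩ := mem_colorsAt.1 he
    have hxw := hφ.adj hw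
    have hsub : blocked φ x t e ⊆ (colorsAt φ w).erase e := by
      intro a ha
      obtain ⟨hax, ha⟩ := mem_blocked.1 ha
      have hae : a ≠ e := fun h => hax (h ▸ he)
      obtain ⟨hat, hr⟩ := ha.resolve_left hae
      refine Finset.mem_erase.2 ⟨hae, ?_⟩
      by_contra haw
      have hr' : (bichromatic φ a e).Adj x w := ⟨hxw.ne, .inr hw⟩
      obtain rfl := hφ.end_unique hax hat haw hr hr'.reachable hxt hxw.ne
      exact hne hw
    have := Finset.card_le_card hsub
    rw [Finset.card_erase_of_mem (mem_colorsAt_of_eq' hw)] at this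
    have := hlow w hw
    omega
  · have hsub : blocked φ x t e ⊆ {e} := by
      intro a ha
      obtain ⟨hax, ha⟩ := mem_blocked.1 ha
      rcases ha with rfl | ⟨-, hr⟩
      · simp
      · exact (not_reachable_of_notMem hxt.symm hax he hr.symm).elim
    exact (Finset.card_le_card hsub).trans (by simp)

theorem IsValid.eq_of_mem_blocked (hφ : IsValid φ) {x t t' : V} {a e : K}
    (he : e ∈ colorsAt φ x) (ht : a ∈ blocked φ x t e) (ht' : a ∈ blocked φ x t' e)
    (hxt : x ≠ t) (hxt' : x ≠ t') : t = t' := by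
  obtain ⟨hax, ht⟩ := mem_blocked.1 ht
  obtain ⟨-, ht'⟩ := mem_blocked.1 ht'
  have hae : a ≠ e := fun h => hax (h ▸ he)
  have ht := ht.resolve_left hae
  have ht' := ht'.resolve_left hae
  exact hφ.end_unique hax ht.1 ht'.1 ht.2 ht'.2 hxt hxt'

open Classical in
/-- The colors of the pairs `xw` with `w ∈ T`. -/
noncomputable def colorsTo (φ : Sym2 V → Option K) (T : Finset V) (x : V) : Finset K :=
  {α | ∃ w ∈ T, φ s(x, w) = some α}

theorem mem_colorsTo {T : Finset V} {x : V} {α : K} :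
    α ∈ colorsTo φ T x ↔ ∃ w ∈ T, φ s(x, w) = some α := by
  simp [colorsTo]

theorem colorsTo_subset (T : Finset V) (x : V) : colorsTo φ T x ⊆ colorsAt φ x := fun _ h =>
  let ⟨_, _, hw⟩ := mem_colorsTo.1 h
  mem_colorsAt_of_eq hw

theorem IsColoringOf.card_colorsTo_le [DecidableEq V] (hφ : IsColoringOf φ H) (T : Finset V) (x : V)
    [Fintype (H.neighborSet x)] : (colorsTo φ T x).card ≤ (H.neighborFinset x ∩ T).card := by
  classical
  rw [← Finset.card_map Function.Embedding.some]
  refine le_trans (Finset.card_le_card ?_)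
    (Finset.card_image_le (s := H.neighborFinset x ∩ T) (f := fun w => φ s(x, w)))
  intro o ho
  obtain ⟨α, hα, rfl⟩ := Finset.mem_map.1 ho
  obtain ⟨w, hwT, hw⟩ := mem_colorsTo.1 hα
  exact Finset.mem_image.2 ⟨w, by simpa [hwT] using hφ.adj hw, hw⟩

/-- A coloring can be extended to an edge `xy`, possibly after recoloring, if `y` has few neighbors,
`x` has few neighbors outside a set of vertices with few neighbors, and there are enough colors. -/
theorem IsColoringOf.exists_sup_edge [Fintype V] [DecidableEq V] [DecidableRel H.Adj]
    {φ₀ : Sym2 V → Option K} (hφ₀ : IsColoringOf φ₀ H) {x y : V} (hxy : x ≠ y)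
    (hadj : ¬ H.Adj x y) (T : Finset V) (hT : (H.neighborFinset x ∩ T).card ≤ 3)
    (hlow : ∀ w ∉ T, H.degree w ≤ 3) (hy : H.degree y ≤ 2)
    (hx : H.degree x + 6 ≤ Fintype.card K) (hdeg : ∀ v, H.degree v + 5 ≤ Fintype.card K) :
    ∃ ψ : Sym2 V → Option K, IsColoringOf ψ (H ⊔ edge x y) := by
  classical
  by_contra! hne
  have cover : ∀ φ : Sym2 V → Option K, IsColoringOf φ H → ∀ a ∉ colorsAt φ x,
      ∃ e ∈ colorsAt φ y, a ∈ blocked φ x y e := by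
    intro φ hφ a ha
    by_contra! h
    exact hne _ (hφ.of_isValid_recolor
      (hφ.1.recolor_of_notMem_blocked hxy ha fun e he _ => h e he) hxy)
  have blocked_le : ∀ φ : Sym2 V → Option K, IsColoringOf φ H → ∀ t e, x ≠ t →
      φ s(x, t) ≠ some e → e ∉ colorsTo φ T x → (blocked φ x t e).card ≤ 2 := by
    intro φ hφ t e hxt hne he
    refine hφ.card_blocked_le hxt hne fun w hw => ?_
    exact (hφ.card_colorsAt_le w).trans (hlow w fun hwT => he (mem_colorsTo.2 ⟨w, hwT, hw⟩))
  have xy_ne : ∀ φ : Sym2 V → Option K, IsColoringOf φ H → ∀ e, φ s(x, y) ≠ some e :=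
    fun φ hφ e he => hadj (hφ.adj he)
  let m : (Sym2 V → Option K) → ℕ := fun φ => (colorsAt φ y ∩ colorsTo φ T x).card
  obtain ⟨φ, hφ, hmin⟩ : ∃ φ : Sym2 V → Option K, IsColoringOf φ H ∧
      ∀ ψ : Sym2 V → Option K, IsColoringOf ψ H → m φ ≤ m ψ := by
    obtain ⟨ψ, hψ, h⟩ := WellFounded.has_min (measure m).wf
      {ψ : Sym2 V → Option K | IsColoringOf ψ H} ⟨φ₀, hφ₀⟩
    exact ⟨ψ, hψ, fun ψ' h' => not_lt.1 (h ψ' h')⟩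
  have small : ∀ φ : Sym2 V → Option K, IsColoringOf φ H → ∀ c ∈ colorsAt φ y,
      ∀ e ∈ colorsAt φ y, ∀ e' ∈ colorsAt φ y, e ≠ c → e' ≠ c → e = e' := by
    intro φ hφ c hc e he e' he' hec he'c
    have h₁ := Finset.card_erase_of_mem hc
    have h₂ := hφ.card_colorsAt_le y
    exact Finset.card_le_one.1 (by omega) e (Finset.mem_erase.2 ⟨hec, he⟩) e'
      (Finset.mem_erase.2 ⟨he'c, he'⟩)
  have shrink : ∀ φ : Sym2 V → Option K, IsColoringOf φ H → ∀ c v d, c ∈ colorsTo φ T x →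
      φ s(y, v) = some c → d ∉ colorsAt φ y → d ∉ colorsTo φ T x → IsValid (recolor φ y v d) →
      m (recolor φ y v d) < m φ := by
    intro φ hφ c v d hc hv hdy hdT hval
    have hcy := mem_colorsAt_of_eq hv
    have hvx : x ≠ v := by
      rintro rfl
      exact hadj (hφ.adj hv).symm
    refine Finset.card_lt_card (Finset.ssubset_iff_of_subset ?_ |>.2 ⟨c, ?_, ?_⟩)
    · intro α hα
      obtain ⟨hαy, hαT⟩ := Finset.mem_inter.1 hα
      obtain ⟨w, hwT, hw⟩ := mem_colorsTo.1 hαT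
      rw [recolor_of_ne d (by simp [hxy, hvx])] at hw
      have hα' := mem_colorsTo.2 ⟨w, hwT, hw⟩
      refine Finset.mem_inter.2 ⟨?_, hα'⟩
      exact (mem_colorsAt_of_mem_recolor hαy).resolve_left (by rintro rfl; exact hdT hα')
    · exact Finset.mem_inter.2 ⟨hcy, hc⟩
    · intro h
      exact hφ.1.notMem_colorsAt_recolor hv (by rintro rfl; exact hdy hcy) (Finset.mem_inter.1 h).1
  -- Otherwise `d` is blocked by a path from `y` to `x`, so no `d`-`e` path joins `y` to `v`, and
  -- recolouring `yv` with `d` lowers `m`. This is stated for every minimiser because it is also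
  -- used after a recolouring.
  have stuck : ∀ φ : Sym2 V → Option K, IsColoringOf φ H →
      (∀ ψ : Sym2 V → Option K, IsColoringOf ψ H → m φ ≤ m ψ) →
      ∀ c v, c ∈ colorsTo φ T x → φ s(y, v) = some c →
      ∀ d, d ∉ colorsAt φ y → d ∉ colorsAt φ v → d ∈ colorsAt φ x := by
    intro φ hφ hmin c v hc hv d hdy hdv
    by_contra hdx
    have hyv := hφ.adj hv
    have hxv : x ≠ v := by
      rintro rfl
      exact hadj hyv.symm
    obtain ⟨e, he, hde⟩ := cover φ hφ d hdx
    obtain ⟨-, hr⟩ := (mem_blocked.1 hde).2.resolve_left (by rintro rfl; exact hdy he)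
    have hnr : ¬ (bichromatic φ d e).Reachable y v := fun h =>
      hxv (hφ.1.end_unique hdy hdx hdv hr.symm h hxy.symm hyv.ne)
    have hec : e ≠ c := by
      rintro rfl
      exact hnr (Adj.reachable ⟨hyv.ne, .inr hv⟩)
    have hval : IsValid (recolor φ y v d) := by
      rw [recolor_comm]
      refine hφ.1.isValid_recolor hyv.ne' hdv hdy fun e' he' hne' hr' => hnr ?_
      have he'c : e' ≠ c := by
        rintro rfl
        exact hne' (by rw [Sym2.eq_swap, hv])
      rw [small φ hφ c (mem_colorsAt_of_eq hv) e he e' he' hec he'c]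
      exact hr'.symm
    exact (shrink φ hφ c v d hc hv hdy (fun h => hdx (colorsTo_subset T x h)) hval).not_ge
      (hmin _ (hφ.of_isValid_recolor_of_adj hval hyv))
  have hA : 6 ≤ (colorsAt φ x)ᶜ.card := by
    rw [Finset.card_compl]
    have := hφ.card_colorsAt_le x
    omega
  -- Without a `T`-colour at `y`, at most `2 * 2 < 6` colours would be blocked.
  obtain ⟨c, hcy, hcT⟩ : ∃ c ∈ colorsAt φ y, c ∈ colorsTo φ T x := by
    by_contra! h
    have hsub : (colorsAt φ x)ᶜ ⊆ (colorsAt φ y).biUnion (blocked φ x y) := fun a ha =>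
      Finset.mem_biUnion.2 (cover φ hφ a (Finset.mem_compl.1 ha))
    have h₁ := (Finset.card_le_card hsub).trans (Finset.card_biUnion_le_card_mul _ _ 2 fun e he =>
      blocked_le φ hφ y e hxy (xy_ne φ hφ e) (h e he))
    have := hφ.card_colorsAt_le y
    omega
  obtain ⟨v, hv⟩ := mem_colorsAt.1 hcy
  have hyv := hφ.adj hv
  have hxv : x ≠ v := by
    rintro rfl
    exact hadj hyv.symm
  have hcv : c ∈ colorsAt φ v := mem_colorsAt_of_eq' hv
  have hB : 5 ≤ (colorsAt φ v)ᶜ.card := by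
    rw [Finset.card_compl]
    have := hφ.card_colorsAt_le v
    have := hdeg v
    omega
  have hTc : ((colorsTo φ T x).erase c).card ≤ 2 := by
    rw [Finset.card_erase_of_mem hcT]
    have := hφ.card_colorsTo_le T x
    omega
  have hyc : ((colorsAt φ y).erase c).card ≤ 1 := by
    rw [Finset.card_erase_of_mem hcy]
    have := hφ.card_colorsAt_le y
    omega
  -- If `b` were missing at `v`, no path in `b` and a colour missing at `v` could reach `v`, so `yv`
  -- could be recoloured. Of the at least 5 colours missing at `v`, at most `2 + 1` must be avoided.
  have other : ∀ b ∈ colorsAt φ y, b ≠ c → b ∈ colorsTo φ T x ∨ b ∈ colorsAt φ v := by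
    intro b hb hbc
    by_contra! hb'
    obtain ⟨d, hd⟩ : ((colorsAt φ v)ᶜ \ ((colorsTo φ T x).erase c ∪
        (colorsAt φ y).erase c)).Nonempty := by
      rw [← Finset.card_pos]
      have h₁ := Finset.le_card_sdiff ((colorsTo φ T x).erase c ∪ (colorsAt φ y).erase c)
        (colorsAt φ v)ᶜ
      have h₂ := Finset.card_union_le ((colorsTo φ T x).erase c) ((colorsAt φ y).erase c)
      omega
    simp only [Finset.mem_sdiff, Finset.mem_compl, Finset.mem_union, Finset.mem_erase, not_or,
      not_and] at hd
    have hdc : d ≠ c := by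
      rintro rfl
      exact hd.1 hcv
    have hdy := hd.2.2 hdc
    have hval : IsValid (recolor φ y v d) := by
      rw [recolor_comm]
      refine hφ.1.isValid_recolor hyv.ne' hd.1 hdy fun e he hne' hr => ?_
      have hec : e ≠ c := by
        rintro rfl
        exact hne' (by rw [Sym2.eq_swap, hv])
      obtain rfl := small φ hφ c hcy e he b hb hec hbc
      exact not_reachable_of_notMem hyv.ne hd.1 hb'.2 hr.symm
    exact (shrink φ hφ c v d hcT hv hdy (hd.2.1 hdc) hval).not_ge
      (hmin _ (hφ.of_isValid_recolor_of_adj hval hyv))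
  set D := (colorsAt φ v)ᶜ \ (colorsTo φ T x).erase c with hDdef
  have hD : 3 ≤ D.card := by
    have := Finset.le_card_sdiff ((colorsTo φ T x).erase c) (colorsAt φ v)ᶜ
    rw [← hDdef] at this
    omega
  have memD : ∀ d ∈ D, d ∉ colorsAt φ v ∧ d ∉ colorsTo φ T x ∧ d ∉ colorsAt φ y := by
    intro d hd
    simp only [hDdef, Finset.mem_sdiff, Finset.mem_compl, Finset.mem_erase, not_and] at hd
    have hdc : d ≠ c := by
      rintro rfl
      exact hd.1 hcv
    exact ⟨hd.1, hd.2 hdc, fun hdy => (other d hdy hdc).elim (hd.2 hdc) hd.1⟩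
  have exz : ∀ d ∈ D, ∃ z, φ s(x, z) = some d := fun d hd =>
    mem_colorsAt.1 (stuck φ hφ hmin c v hcT hv d (memD d hd).2.2 (memD d hd).1)
  have : Nonempty V := ⟨x⟩
  choose! z hz using exz
  have hxz : ∀ d ∈ D, x ≠ z d := fun d hd => (hφ.adj (hz d hd)).ne
  have hyz : ∀ d ∈ D, y ≠ z d := by
    intro d hd h
    exact xy_ne φ hφ d (h ▸ hz d hd)
  have hvz : ∀ d ∈ D, v ≠ z d := by
    intro d hd h
    exact (memD d hd).1 (h ▸ mem_colorsAt_of_eq' (hz d hd))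
  have z_inj : ∀ d ∈ D, ∀ d' ∈ D, z d = z d' → d = d' := by
    intro d hd d' hd' h
    have h₁ := hz d hd
    rw [h, hz d' hd'] at h₁
    exact (Option.some_injective _ h₁).symm
  -- Recolouring `xz` with `a` would leave `m` unchanged but make `d` missing at `x`, against
  -- `stuck`.
  have cover' : ∀ d ∈ D, ∀ a ∈ (colorsAt φ x)ᶜ,
      ∃ e ∈ (colorsAt φ (z d)).erase d, a ∈ blocked φ x (z d) e := by
    intro d hd a ha
    by_contra! h
    rw [Finset.mem_compl] at ha
    obtain ⟨hdv, hdT, hdy⟩ := memD d hd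
    have hzT : z d ∉ T := fun h => hdT (mem_colorsTo.2 ⟨z d, h, hz d hd⟩)
    have hval : IsValid (recolor φ x (z d) a) :=
      hφ.1.recolor_of_notMem_blocked (hxz d hd) ha fun e he hne' =>
        h e (Finset.mem_erase.2 ⟨by rintro rfl; exact hne' (hz e hd), he⟩)
    have hψ := hφ.of_isValid_recolor_of_adj hval (hφ.adj (hz d hd))
    have hy' : colorsAt (recolor φ x (z d) a) y = colorsAt φ y :=
      colorsAt_recolor_of_ne a hxy.symm (hyz d hd)
    have hT' : colorsTo (recolor φ x (z d) a) T x = colorsTo φ T x := by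
      ext α
      simp only [mem_colorsTo]
      refine exists_congr fun w => and_congr_right fun hw => ?_
      rw [recolor_of_ne]
      rw [Ne, Sym2.congr_right]
      rintro rfl
      exact hzT hw
    have hv' : recolor φ x (z d) a s(y, v) = some c := by
      rw [recolor_of_ne _ (by simp [hxy.symm, hxv.symm]), hv]
    have hm : m (recolor φ x (z d) a) = m φ := by
      simp only [m, hy', hT']
    refine hφ.1.notMem_colorsAt_recolor (a := a) (hz d hd) ?_
      (stuck _ hψ (by rw [hm]; exact hmin) c v (hT' ▸ hcT) hv' d (hy' ▸ hdy) ?_)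
    · rintro rfl
      exact ha (mem_colorsAt_of_eq (hz d hd))
    · rw [colorsAt_recolor_of_ne a hxv.symm (hvz d hd)]
      exact hdv
  have hE : ∀ d ∈ D, ((colorsAt φ (z d)).erase d).card ≤ 2 := by
    intro d hd
    rw [Finset.card_erase_of_mem (mem_colorsAt_of_eq' (hz d hd))]
    have h₁ := hφ.card_colorsAt_le (z d)
    have h₂ := hlow (z d) fun h => (memD d hd).2.1 (mem_colorsTo.2 ⟨z d, h, hz d hd⟩)
    omega
  have blocked_le' : ∀ d ∈ D, ∀ e ∈ (colorsAt φ (z d)).erase d, e ∉ colorsTo φ T x →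
      (blocked φ x (z d) e).card ≤ 2 := by
    intro d hd e he heT
    refine blocked_le φ hφ (z d) e (hxz d hd) ?_ heT
    rw [hz d hd]
    exact fun h => Finset.ne_of_mem_erase he (Option.some_injective _ h).symm
  have once : ∀ d ∈ D, ∀ d' ∈ D, ∀ e ∈ colorsTo φ T x, ∀ a, a ∈ blocked φ x (z d) e →
      a ∈ blocked φ x (z d') e → d = d' := fun d hd d' hd' e he a ha ha' =>
    z_inj d hd d' hd' (hφ.1.eq_of_mem_blocked (colorsTo_subset T x he) ha ha' (hxz d hd)
      (hxz d' hd'))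
  have once' : ∀ d ∈ D, ∀ e ∈ colorsTo φ T x, ∀ a, a ∈ blocked φ x (z d) e →
      a ∉ blocked φ x y e := fun d hd e he a ha ha' =>
    hyz d hd (hφ.1.eq_of_mem_blocked (colorsTo_subset T x he) ha' ha hxy (hxz d hd))
  have once_of_card : ∀ S ⊆ colorsTo φ T x, S.card ≤ 1 → ∀ d ∈ D, ∀ d' ∈ D, ∀ e ∈ S, ∀ e' ∈ S,
      ∀ a ∈ (colorsAt φ x)ᶜ, a ∈ blocked φ x (z d) e → a ∈ blocked φ x (z d') e' → d = d' := by
    intro S hS hcard d hd d' hd' e he e' he' a _ ha ha'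
    obtain rfl := Finset.card_le_one.1 hcard e he e' he'
    exact once d hd d' hd' e (hS he) a ha ha'
  -- Group the at most three `T`-colours into two families that block each `a` for at most one `d`.
  -- If both colours at `y` are `T`-colours, the families are `{b, c}` and the rest; otherwise `c`
  -- is treated as a small colour and the rest is split into singletons.
  by_cases hb : ∃ b ∈ colorsAt φ y, b ≠ c ∧ b ∈ colorsTo φ T x
  · obtain ⟨b, hby, hbc, hbT⟩ := hb
    have hpair : ∀ e ∈ ({b, c} : Finset K), e ∈ colorsTo φ T x := by
      simp [hbT, hcT]
    have hS : (((colorsTo φ T x).erase c).erase b).card ≤ 1 := by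
      rw [Finset.card_erase_of_mem (Finset.mem_erase.2 ⟨hbc, hbT⟩)]
      omega
    refine false_of_forall_exists_mem hA hD hE (B := fun d e => blocked φ x (z d) e) cover' {b, c}
      (((colorsTo φ T x).erase c).erase b) ?_ ?_
      (once_of_card _ ((Finset.erase_subset _ _).trans (Finset.erase_subset _ _)) hS)
    · intro d hd e he h₁ h₂
      refine blocked_le' d hd e he fun h => ?_
      simp only [Finset.mem_insert, Finset.mem_singleton, not_or] at h₁
      exact h₂ (Finset.mem_erase.2 ⟨h₁.1, Finset.mem_erase.2 ⟨h₁.2, h⟩⟩)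
    · intro d hd d' hd' e he e' he' a ha hae hae'
      -- One of `b`, `c` already blocks `a` towards `y`, so only the other can block it towards some
      -- `z`.
      obtain ⟨f, hf, haf⟩ := cover φ hφ a (Finset.mem_compl.1 ha)
      have hfe : e ≠ f := by
        rintro rfl
        exact once' d hd e (hpair e he) a hae haf
      have hfe' : e' ≠ f := by
        rintro rfl
        exact once' d' hd' e' (hpair e' he') a hae' haf
      have hmem : ∀ g ∈ ({b, c} : Finset K), g ∈ colorsAt φ y := by
        simp [hby, hcy]
      obtain rfl := small φ hφ f hf e (hmem e he) e' (hmem e' he') hfe hfe'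
      exact once d hd d' hd' e (hpair e he) a hae hae'
  · push Not at hb
    obtain ⟨S, hS, hS'⟩ : ∃ S ⊆ (colorsTo φ T x).erase c,
        S.card ≤ 1 ∧ ((colorsTo φ T x).erase c \ S).card ≤ 1 := by
      rcases ((colorsTo φ T x).erase c).eq_empty_or_nonempty with h | ⟨s, hs⟩
      · exact ⟨∅, by simp, by simp, by simp [h]⟩
      · refine ⟨{s}, by simpa using hs, by simp, ?_⟩
        rw [Finset.sdiff_singleton_eq_erase, Finset.card_erase_of_mem hs]
        omega
    have hsub := Finset.erase_subset c (colorsTo φ T x)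
    refine false_of_forall_exists_mem hA hD hE (B := fun d e => blocked φ x (z d) e) cover' S
      ((colorsTo φ T x).erase c \ S) ?_ (once_of_card _ (hS.trans hsub) hS'.1)
      (once_of_card _ (Finset.sdiff_subset.trans hsub) hS'.2)
    intro d hd e he h₁ h₂
    by_cases hec : e = c
    · subst hec
      -- What `c` blocks towards `z d` it does not block towards `y`, so there it is blocked by the
      -- other colour, which is not a `T`-colour and blocks at most 2.
      have hsub' : blocked φ x (z d) e ⊆ ((colorsAt φ y).erase e).biUnion (blocked φ x y) := by
        intro a ha
        obtain ⟨f, hf, haf⟩ := cover φ hφ a (mem_blocked.1 ha).1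
        refine Finset.mem_biUnion.2 ⟨f, Finset.mem_erase.2 ⟨?_, hf⟩, haf⟩
        rintro rfl
        exact once' d hd f hcT a ha haf
      have := (Finset.card_le_card hsub').trans (Finset.card_biUnion_le_card_mul _ _ 2 fun f hf =>
        blocked_le φ hφ y f hxy (xy_ne φ hφ f)
          (hb f (Finset.mem_of_mem_erase hf) (Finset.ne_of_mem_erase hf)))
      omega
    · refine blocked_le' d hd e he fun h => h₂ ?_
      exact Finset.mem_sdiff.2 ⟨Finset.mem_erase.2 ⟨hec, h⟩, h₁⟩

end PartialColoring
-- Choosing the edge in a degenerate graph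
theorem IsDegenerate.anti {V : Type*} {G H : SimpleGraph V} {k : ℕ} (hG : G.IsDegenerate k)
    (h : H ≤ G) : H.IsDegenerate k := fun S hS =>
  hG ⟨S.verts, S.Adj, fun hS => h (S.adj_sub hS), S.edge_vert, S.symm⟩ hS

/-- A `k`-degenerate graph with an edge has an edge `xy` such that `y` has at most `k` neighbors and
`x` has at most `k` neighbors with more than `k` neighbors. -/
theorem IsDegenerate.exists_adj {V : Type*} [Fintype V] [DecidableEq V] {G : SimpleGraph V}
    [DecidableRel G.Adj] {k : ℕ} (hG : G.IsDegenerate k) (hne : G ≠ ⊥) :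
    ∃ x y, G.Adj x y ∧ G.degree y ≤ k ∧
      (G.neighborFinset x ∩ ({w | k < G.degree w} : Finset V)).card ≤ k := by
  set T : Finset V := {w | k < G.degree w} with hT
  rcases T.eq_empty_or_nonempty with h | h
  · obtain ⟨x, y, hxy⟩ := ne_bot_iff_exists_adj.1 hne
    refine ⟨x, y, hxy, ?_, by simp [h]⟩
    by_contra! hy
    have : y ∈ T := by simpa [hT] using hy
    simp [h] at this
  -- Degeneracy of the subgraph induced on `T` gives `x`; having more than `k` neighbours in `G`, it
  -- has one outside `T`.
  · obtain ⟨x, hx, hcard⟩ := hG ((⊤ : G.Subgraph).induce T) (by simpa using h)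
    have hxT : x ∈ T := by simpa using hx
    have heq : ((⊤ : G.Subgraph).induce T).neighborSet x = ((G.neighborFinset x ∩ T : Finset V) :
        Set V) := by
      ext w
      simp [hxT, and_comm]
    rw [heq, Set.encard_coe_eq_coe_finsetCard, Nat.cast_le] at hcard
    have hdeg : k < (G.neighborFinset x).card := by simpa [hT] using hxT
    obtain ⟨y, hy⟩ : (G.neighborFinset x \ T).Nonempty := by
      rw [← Finset.card_pos]
      have := Finset.card_inter_add_card_sdiff (G.neighborFinset x) T
      omega
    rw [Finset.mem_sdiff, mem_neighborFinset] at hy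
    exact ⟨x, y, hy.1, by simpa [hT] using hy.2, hcard⟩

/-! ### Induction on edges and return to edge labelings -/

namespace PartialColoring

theorem exists_isColoringOf {V : Type*} [Fintype V] (G : SimpleGraph V) (hG : G.IsDegenerate 3)
    (Δ : ℕ) (hΔ : ∀ v, (G.neighborSet v).ncard ≤ Δ) :
    ∃ φ : Sym2 V → Option (Fin (Δ + 5)), IsColoringOf φ G := by
  classical
  induction G using WellFoundedLT.induction with
  | ind G ih =>
  by_cases hne : G = ⊥
  · subst hne
    refine ⟨fun _ => none, ⟨⟨by simp, fun α β _ => ?_⟩, by simp⟩⟩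
    convert isAcyclic_bot
    ext
    simp [bichromatic]
  · obtain ⟨x, y, hxy, hy, hx⟩ := hG.exists_adj hne
    have hsup : G \ edge x y ⊔ edge x y = G := by
      refine sdiff_sup_cancel ?_
      intro u v huv
      rw [← mem_edgeSet, ← (adj_edge x y).1 huv |>.1]
      exact hxy
    have hnadj : ¬ (G \ edge x y).Adj x y := by simp [edge_adj, hxy.ne]
    have hle : G \ edge x y ≤ G := sdiff_le
    have hlt : G \ edge x y < G := lt_of_le_of_ne hle fun h => hnadj (h.symm ▸ hxy)
    have hle' : ∀ v, (G \ edge x y).degree v ≤ G.degree v := fun v => degree_le_of_le hle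
    have hsub : ∀ v, (G \ edge x y).neighborFinset v ⊆ G.neighborFinset v := by
      intro v w hw
      rw [mem_neighborFinset] at hw ⊢
      exact hle hw
    have hlt' : ∀ u v, G.Adj u v → ¬ (G \ edge x y).Adj u v →
        (G \ edge x y).degree u < G.degree u := by
      intro u v h h'
      refine Finset.card_lt_card ((Finset.ssubset_iff_of_subset (hsub u)).2 ⟨v, ?_, ?_⟩)
      · rwa [mem_neighborFinset]
      · rwa [mem_neighborFinset]
    have hdeg : ∀ v, G.degree v ≤ Δ := by
      intro v
      have := hΔ v
      rwa [Set.ncard_eq_toFinset_card'] at this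
    obtain ⟨φ, hφ⟩ := ih _ hlt (hG.anti hle) fun v =>
      (Set.ncard_le_ncard (fun w hw => hle hw) (Set.toFinite _)).trans (hΔ v)
    have h := hφ.exists_sup_edge hxy.ne hnadj {w | 3 < G.degree w}
      ((Finset.card_le_card (Finset.inter_subset_inter_right (hsub x))).trans hx)
      (fun w hw => (hle' w).trans (by simpa using hw))
      -- Deleting `xy` lowers both end degrees by one: hence 2 at `y`, and 6 rather than 5 spare
      -- colours at `x`.
      (by have := hlt' y x hxy.symm fun h => hnadj h.symm; omega)
      (by have := hlt' x y hxy hnadj; have := hdeg x; simp only [Fintype.card_fin]; omega)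
      (fun v => by have := hle' v; have := hdeg v; simp only [Fintype.card_fin]; omega)
    rwa [hsup] at h

theorem IsColoringOf.acyclicEdgeColorable {V : Type*} {G : SimpleGraph V} {n : ℕ}
    {φ : Sym2 V → Option (Fin n)} (hφ : IsColoringOf φ G) : G.AcyclicEdgeColorable n := by
  have hex : ∀ e : G.edgeSet, ∃ a, φ e = some a := by
    rintro ⟨e, he⟩
    induction e using Sym2.ind with
    | _ u v => exact Option.ne_none_iff_exists'.1 ((hφ.ne_none_iff u v).2 he)
  choose C hC using hex
  refine ⟨C, ?_, ?_⟩
  · rintro e₁ e₂ hne ⟨v, h₁, h₂⟩ heq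
    obtain ⟨w₁, hw₁⟩ := Sym2.mem_iff_exists.1 h₁
    obtain ⟨w₂, hw₂⟩ := Sym2.mem_iff_exists.1 h₂
    have h₁ := hC e₁
    have h₂ := hC e₂
    rw [hw₁] at h₁
    rw [hw₂, ← heq] at h₂
    exact hne (Subtype.ext (by rw [hw₁, hw₂, hφ.proper _ _ _ _ h₁ h₂]))
  · intro v p hp hcard
    obtain ⟨α, β, hαβ, hcol⟩ := Set.encard_eq_two.1 hcard
    have hmem : ∀ e ∈ p.edges, e ∈ (bichromatic φ α β).edgeSet := by
      intro e he
      have heG := p.edges_subset_edgeSet he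
      have hc : C ⟨e, heG⟩ ∈ EdgeLabeling.walkColors C p := ⟨⟨e, heG⟩, he, rfl⟩
      have hCe := hC ⟨e, heG⟩
      rw [hcol] at hc
      induction e using Sym2.ind with
      | _ u w =>
        refine ⟨G.ne_of_adj heG, ?_⟩
        rcases hc with hc | hc
        · rw [hc] at hCe
          exact .inl hCe
        · rw [hc] at hCe
          exact .inr hCe
    exact hφ.acyclic α β hαβ _ (hp.transfer hmem)

end PartialColoring
end SimpleGraph

theorem theorem2 {V : Type*} [Fintype V] (G : SimpleGraph V) [DecidableRel G.Adj]
    (hG : G.IsDegenerate 3) :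
    G.acyclicChromaticIndex ≤ ((G.maxDegree + 5 : ℕ) : ℕ∞) := by
  obtain ⟨φ, hφ⟩ := SimpleGraph.PartialColoring.exists_isColoringOf G hG G.maxDegree fun v => by
    rw [Set.ncard_eq_toFinset_card']
    exact G.degree_le_maxDegree v
  exact iInf₂_le _ hφ.acyclicEdgeColorable
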